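/- **Theorem 2 (Lower Bound).** For an integer $n\ge 1$ and a real number $D$, let $WC_\Delta(n,D)$ be the following perfect information game of two players, Waiter and Client, on the edges of the complete graph $K_n$. In every round Waiter offers Client two edges that have not been offered before; Client claims one of them and Waiter claims the other. When fewer than two edges that have not been offered remain, Waiter claims them and the game ends. Waiter wins if at the end of the game the graph formed by Client's edges has a vertex of degree at least $D$; otherwise Client wins. There is an integer $n_0$ such that for every $n\ge n_0$ Waiter has a strategy to win $$WC_\Delta\left(n,\ \frac n2+\frac{\sqrt{n\ln n}}{500}\right).$$ -/

import Mathlib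

/-! ### Waiter-Client games -/

namespace WaiterClient

/-- One round of the game: the set of elements offered by Waiter, and the element of it that
Client claimed. Waiter claims the other offered elements. -/
structure Round (α : Type*) where
  offer : Finset α
  claim : α

/-- The history of a game: the list of the rounds played so far, most recent round first. -/
abbrev History (α : Type*) := List (Round α)

section
variable {α : Type*} [DecidableEq α]

/-- The elements that have been offered so far. -/
def offered : History α → Finset α
  | [] => ∅
  | r :: h => r.offer ∪ offered h

/-- The elements that Client has claimed so far. -/
def clientSet : History α → Finset α
  | [] => ∅
  | r :: h => insert r.claim (clientSet h)

/-- The elements of the board that have not been offered so far. -/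
def free (board : Finset α) (h : History α) : Finset α :=
  board \ offered h

/-- A strategy of Waiter: it prescribes the set to be offered next, as a function of the history. -/
abbrev WaiterStrategy (α : Type*) := History α → Finset α

/-- `IsPlay board q σ h`: the history `h` can arise on the given board, with bias `q`, when Waiter
follows `σ` and Client claims an arbitrary offered element in each round. A new round is played as
long as at least `q + 1` elements are free. -/
inductive IsPlay (board : Finset α) (q : ℕ) (σ : WaiterStrategy α) : History α → Prop
  | start : IsPlay board q σ []
  | round (h : History α) (x : α) (hplay : IsPlay board q σ h)
      (hfree : q + 1 ≤ (free board h).card) (hx : x ∈ σ h) :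
      IsPlay board q σ (⟨σ h, x⟩ :: h)

/-- The strategy `σ` obeys the rules: in each play, whenever at least `q + 1` elements are free, it
offers exactly `q + 1` elements, all of them free. -/
def WaiterStrategy.IsLegal (board : Finset α) (q : ℕ) (σ : WaiterStrategy α) : Prop :=
  ∀ h : History α, IsPlay board q σ h → q + 1 ≤ (free board h).card →
    σ h ⊆ free board h ∧ (σ h).card = q + 1

/-- Waiter has a strategy to win the game with bias `q` in which Waiter wins if and only if the set
`C` of all the elements claimed by Client at the end satisfies `waiterWins C`. The game ends when
fewer than `q + 1` free elements remain (these go to Waiter, so Client's set is not affected). -/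
def WaiterHasWinningStrategy (board : Finset α) (q : ℕ) (waiterWins : Finset α → Prop) : Prop :=
  ∃ σ : WaiterStrategy α, σ.IsLegal board q ∧
    ∀ h : History α, IsPlay board q σ h → (free board h).card < q + 1 → waiterWins (clientSet h)

end

/-- Waiter has a strategy to win the maximum degree game `WC_Δ(n, q, D)`: the game with bias `q` on
the edges of the complete graph on `n` vertices in which Waiter wins if and only if at the end some
vertex has degree at least `D` in the graph formed by Client's edges. -/
def WaiterWinsMaxDegree (n q : ℕ) (D : ℝ) : Prop :=
  WaiterHasWinningStrategy (⊤ : SimpleGraph (Fin n)).edgeFinset q fun C =>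
    ∃ v : Fin n, D ≤ ((SimpleGraph.fromEdgeSet (C : Set (Sym2 (Fin n)))).degree v : ℝ)

end WaiterClient

/-!
Waiter wins by simulating `n / 2` steps of a simple random walk with about `n / 2` walkers. The
vertices are split into a set `A` of centers and a set `B`. Give each vertex the `level` that is
twice Client's degree plus the number of free edges. If Waiter offers `uv` and `uw` with `u ∈ A` and
`v, w ∈ B`, the level of one of `v`, `w` goes up by one, that of the other goes down by one, and all
other levels stay the same. For each center `u` in turn, Waiter pairs up vertices of `B` of equal
level in this way, as long as there are such pairs; distinct centers use disjoint sets of edges.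

The potential `∑ v ∈ B, θ ^ level v`, with `θ > 1`, then increases independently of Client's choices
(`potential_offer_pair`). With each center it would be multiplied by `1 + (θ - 1) ^ 2 / (2 * θ)`, if
it were not for the vertices left without a partner; but these have distinct levels. As long as all
levels are below `M`, they account for at most `∑ k < M, θ ^ k`, and so the excess of the potential
over this geometric sum does grow by that factor (`winningPosition_of_center`). For
`θ = 1 + √(log n / n)` the sum is small compared with the initial potential, and the growth forces a
vertex up to the level `M = n + √(n log n) / 250 + O(1)` (`winningPosition_of_potential`,
`waiterWinsMaxDegree_of_large`).

Once a vertex `v` has reached level `M`, Waiter offers pairs of edges at `v` until at most one of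
them is free. As Client takes one edge of each pair, Client's degree at `v` ends up at least
`(M - 1) / 2` (`winningPosition_of_le_level`).

Strategies as functions of the history are dealt with once and for all by
`WinningPosition.hasWinningStrategy`, which reduces the game to positions.
-/

namespace WaiterClient

/-! ### Winning positions -/

section WinningPosition

variable {α : Type*} [DecidableEq α]

/-- `WinningPosition q P F C`: when `F` is the set of free elements and `C` the set of the elements
claimed by Client so far, Waiter can force that Client's final set satisfies `P`. Only the pair
`(F, C)` is recorded, because the rest of the history does not affect the continuation. -/
inductive WinningPosition (q : ℕ) (P : Finset α → Prop) : Finset α → Finset α → Prop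
  | final {F C : Finset α} (hF : F.card < q + 1) (hC : P C) : WinningPosition q P F C
  | offer {F C : Finset α} (S : Finset α) (hSF : S ⊆ F) (hS : S.card = q + 1)
      (h : ∀ x ∈ S, WinningPosition q P (F \ S) (insert x C)) : WinningPosition q P F C

theorem WinningPosition.of_card_lt {q : ℕ} {P : Finset α → Prop} {F C : Finset α}
    (h : WinningPosition q P F C) (hF : F.card < q + 1) : P C := by
  cases h with
  | final _ hC => exact hC
  | offer S hSF hS _ =>
    have := Finset.card_le_card hSF
    omega

theorem WinningPosition.exists_offer {q : ℕ} {P : Finset α → Prop} {F C : Finset α}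
    (h : WinningPosition q P F C) (hF : q + 1 ≤ F.card) :
    ∃ S ⊆ F, S.card = q + 1 ∧ ∀ x ∈ S, WinningPosition q P (F \ S) (insert x C) := by
  cases h with
  | final hF' _ => omega
  | offer S hSF hS h => exact ⟨S, hSF, hS, h⟩

theorem free_cons (board : Finset α) (r : Round α) (h : History α) :
    free board (r :: h) = free board h \ r.offer := by
  ext x
  simp only [free, offered, Finset.mem_sdiff, Finset.mem_union]
  tauto

/-- The strategy offers, in each winning position, a set that leads to winning positions only. -/
theorem WinningPosition.hasWinningStrategy {board : Finset α} {q : ℕ} {P : Finset α → Prop}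
    (hwin : WinningPosition q P board ∅) : WaiterHasWinningStrategy board q P := by
  classical
  have hchoice : ∀ h : History α, ∃ S : Finset α,
      WinningPosition q P (free board h) (clientSet h) → q + 1 ≤ (free board h).card →
        S ⊆ free board h ∧ S.card = q + 1 ∧
          ∀ x ∈ S, WinningPosition q P (free board h \ S) (insert x (clientSet h)) := by
    intro h
    by_cases hw : WinningPosition q P (free board h) (clientSet h) ∧
        q + 1 ≤ (free board h).card
    · obtain ⟨S, hS⟩ := hw.1.exists_offer hw.2
      exact ⟨S, fun _ _ => hS⟩
    · exact ⟨∅, fun h₁ h₂ => absurd ⟨h₁, h₂⟩ hw⟩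
  choose σ hσ using hchoice
  have hinv : ∀ h : History α, IsPlay board q σ h →
      WinningPosition q P (free board h) (clientSet h) := by
    intro h hplay
    induction hplay with
    | start => simpa [free, offered, clientSet] using hwin
    | round h x _ hfree hx ih =>
      rw [free_cons]
      exact (hσ h ih hfree).2.2 x hx
  exact ⟨σ, fun h hplay hfree => ⟨(hσ h (hinv h hplay) hfree).1, (hσ h (hinv h hplay) hfree).2.1⟩,
    fun h hplay hfree => (hinv h hplay).of_card_lt hfree⟩

end WinningPosition

/-! ### Levels and the exponential potential -/

theorem sum_pow_le_geom_sum_of_injOn {θ : ℝ} (hθ : 0 ≤ θ) {ι : Type*} {S : Finset ι} {f : ι → ℕ}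
    {M : ℕ} (hf : Set.InjOn f S) (hM : ∀ i ∈ S, f i < M) :
    ∑ i ∈ S, θ ^ f i ≤ ∑ k ∈ Finset.range M, θ ^ k := by
  rw [← Finset.sum_image (f := fun k => θ ^ k) hf]
  refine Finset.sum_le_sum_of_subset_of_nonneg ?_ fun _ _ _ => by positivity
  intro k hk
  obtain ⟨v, hv, rfl⟩ := Finset.mem_image.1 hk
  exact Finset.mem_range.2 (hM v hv)

section EdgeGame

variable {V : Type*} [DecidableEq V]

/-- The number of elements of `E` that are incident with `v`. -/
def incidenceCount (E : Finset (Sym2 V)) (v : V) : ℕ :=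
  (E.filter (v ∈ ·)).card

theorem degree_fromEdgeSet_eq_incidenceCount [Fintype V] {C : Finset (Sym2 V)}
    (hC : ∀ e ∈ C, ¬ e.IsDiag) (v : V)
    [Fintype ((SimpleGraph.fromEdgeSet (C : Set (Sym2 V))).neighborSet v)] :
    (SimpleGraph.fromEdgeSet (C : Set (Sym2 V))).degree v = incidenceCount C v := by
  classical
  rw [← SimpleGraph.card_incidenceFinset_eq_degree, incidenceCount]
  congr 1
  ext e
  simp only [SimpleGraph.mem_incidenceFinset, SimpleGraph.incidenceSet,
    SimpleGraph.edgeSet_fromEdgeSet, Set.mem_ofPred_eq, Set.mem_sdiff, Finset.mem_coe,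
    Finset.mem_filter, Sym2.mem_diagSet]
  have := hC e
  tauto

/-- Twice the number of Client's edges at `v` plus the number of free edges at `v`. Up to a constant
this is the number of Client's edges minus the number of Waiter's edges at `v`. -/
def level (F C : Finset (Sym2 V)) (v : V) : ℕ :=
  2 * incidenceCount C v + incidenceCount F v

theorem incidenceCount_insert {E : Finset (Sym2 V)} {e : Sym2 V} (he : e ∉ E) (v : V) :
    incidenceCount (insert e E) v = incidenceCount E v + if v ∈ e then 1 else 0 := by
  unfold incidenceCount
  rw [Finset.filter_insert]
  split_ifs with h
  · rw [Finset.card_insert_of_notMem (by simp [he])]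
  · rfl

theorem incidenceCount_sdiff_pair {E : Finset (Sym2 V)} {e f : Sym2 V} (he : e ∈ E) (hf : f ∈ E)
    (hef : e ≠ f) (v : V) :
    incidenceCount (E \ {e, f}) v + (if v ∈ e then 1 else 0) + (if v ∈ f then 1 else 0) =
      incidenceCount E v := by
  have hE : E = insert e (insert f (E \ {e, f})) := by
    ext x
    simp only [Finset.mem_insert, Finset.mem_sdiff, Finset.mem_singleton]
    constructor
    · tauto
    · rintro (rfl | rfl | h)
      exacts [he, hf, h.1]
  conv_rhs => rw [hE]
  rw [incidenceCount_insert (by simp [hef]), incidenceCount_insert (by simp)]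
  ring

theorem level_offer_pair {F C : Finset (Sym2 V)} (hFC : Disjoint F C) {e f : Sym2 V} (he : e ∈ F)
    (hf : f ∈ F) (hef : e ≠ f) (v : V) :
    level (F \ {e, f}) (insert e C) v + (if v ∈ f then 1 else 0) =
      level F C v + if v ∈ e then 1 else 0 := by
  have h₁ := incidenceCount_sdiff_pair he hf hef v
  have h₂ := incidenceCount_insert (Finset.disjoint_left.1 hFC he) v
  unfold level
  omega

theorem disjoint_sdiff_insert {F C S : Finset (Sym2 V)} (hFC : Disjoint F C) {e : Sym2 V}
    (he : e ∈ S) : Disjoint (F \ S) (insert e C) := by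
  rw [Finset.disjoint_left] at hFC ⊢
  intro x hx
  simp only [Finset.mem_sdiff, Finset.mem_insert, not_or] at hx ⊢
  exact ⟨fun h => hx.2 (h ▸ he), hFC hx.1⟩

/-- Client's degree at `v` plus half the number of free edges at `v`, rounded down, never decreases
if Waiter offers two edges at `v` as long as that is possible and plays arbitrarily afterwards. -/
theorem winningPosition_of_le_incidenceCount {D : ℝ} (F C : Finset (Sym2 V)) (v : V)
    (hFC : Disjoint F C) (hv : D ≤ ((incidenceCount C v + incidenceCount F v / 2 : ℕ) : ℝ)) :
    WinningPosition 1 (fun C => ∃ v, D ≤ (incidenceCount C v : ℝ)) F C := by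
  induction hn : F.card using Nat.strong_induction_on generalizing F C with
  | _ n ih =>
  subst hn
  by_cases hF : F.card < 2
  · have : incidenceCount F v ≤ F.card := Finset.card_filter_le _ _
    refine .final hF ⟨v, ?_⟩
    rwa [show incidenceCount F v / 2 = 0 by omega, add_zero] at hv
  · -- two edges at `v` if possible, else any two edges
    obtain ⟨S, hSF, hS, hSv⟩ : ∃ S ⊆ F, S.card = 2 ∧
        (2 ≤ incidenceCount F v → ∀ e ∈ S, v ∈ e) := by
      by_cases h2 : 2 ≤ incidenceCount F v
      · obtain ⟨S, hS, hc⟩ := Finset.exists_subset_card_eq h2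
        exact ⟨S, hS.trans (Finset.filter_subset _ _), hc,
          fun _ e he => (Finset.mem_filter.1 (hS he)).2⟩
      · obtain ⟨S, hS, hc⟩ := Finset.exists_subset_card_eq (not_lt.1 hF)
        exact ⟨S, hS, hc, fun h => absurd h h2⟩
    refine .offer S hSF hS fun x hx => ih _ ?_ _ _ (disjoint_sdiff_insert hFC hx) ?_ rfl
    · rw [Finset.card_sdiff_of_subset hSF]
      omega
    · refine hv.trans (Nat.cast_le.2 ?_)
      have hxC : x ∉ C := Finset.disjoint_left.1 hFC (hSF hx)
      rw [incidenceCount_insert hxC]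
      by_cases h2 : 2 ≤ incidenceCount F v
      · obtain ⟨e, f, hef, rfl⟩ := Finset.card_eq_two.1 hS
        have h := incidenceCount_sdiff_pair (hSF (by simp)) (hSF (by simp)) hef v (E := F)
        rw [if_pos (hSv h2 e (by simp)), if_pos (hSv h2 f (by simp))] at h
        rw [if_pos (hSv h2 x hx)]
        omega
      · omega

theorem winningPosition_of_le_level {D : ℝ} {M : ℕ} (hM : 2 * D + 1 ≤ M) {F C : Finset (Sym2 V)}
    (hFC : Disjoint F C) {v : V} (hv : M ≤ level F C v) :
    WinningPosition 1 (fun C => ∃ v, D ≤ (incidenceCount C v : ℝ)) F C := by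
  refine winningPosition_of_le_incidenceCount F C v hFC ?_
  have h : M ≤ 2 * (incidenceCount C v + incidenceCount F v / 2) + 1 := by
    unfold level at hv
    omega
  have h' : (M : ℝ) ≤ 2 * ((incidenceCount C v + incidenceCount F v / 2 : ℕ) : ℝ) + 1 := by
    exact_mod_cast h
  linarith

/-- The exponential potential of the vertices in `B`. -/
noncomputable def potential (θ : ℝ) (B : Finset V) (F C : Finset (Sym2 V)) : ℝ :=
  ∑ v ∈ B, θ ^ level F C v

/-- Offering `uv` and `uw`, where `v` and `w` have the same level, moves one of `v` and `w` up and
the other down by one level, and so increases the potential by the same amount whatever Client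
does. -/
theorem potential_offer_pair {θ : ℝ} (hθ : 0 < θ) {B : Finset V} {F C : Finset (Sym2 V)}
    (hFC : Disjoint F C) {u v w : V} (hu : u ∉ B) (hv : v ∈ B) (hw : w ∈ B) (hvw : v ≠ w)
    (he : s(u, v) ∈ F) (hf : s(u, w) ∈ F) (hlevel : level F C v = level F C w) :
    potential θ B (F \ {s(u, v), s(u, w)}) (insert s(u, v) C) =
      potential θ B F C + (θ - 1) ^ 2 / (2 * θ) * (θ ^ level F C v + θ ^ level F C w) := by
  have huv : u ≠ v := fun h => hu (h ▸ hv)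
  have huw : u ≠ w := fun h => hu (h ▸ hw)
  have hef : s(u, v) ≠ s(u, w) := by simp [hvw, huw]
  have hL := level_offer_pair hFC he hf hef
  have hsub : ({v, w} : Finset V) ⊆ B := by
    simp [Finset.insert_subset_iff, hv, hw]
  unfold potential
  rw [← Finset.sum_sdiff hsub, ← Finset.sum_sdiff hsub (f := fun v => θ ^ level F C v),
    Finset.sum_pair hvw, Finset.sum_pair hvw]
  have hrest : ∀ z ∈ B \ {v, w},
      θ ^ level (F \ {s(u, v), s(u, w)}) (insert s(u, v) C) z = θ ^ level F C z := by
    intro z hz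
    simp only [Finset.mem_sdiff, Finset.mem_insert, Finset.mem_singleton, not_or] at hz
    have hzu : z ≠ u := fun h => hu (h ▸ hz.1)
    have h := hL z
    simp only [Sym2.mem_iff, hzu, hz.2.1, hz.2.2, or_self, if_false, add_zero] at h
    rw [h]
  rw [Finset.sum_congr rfl hrest]
  have h₁ := hL v
  have h₂ := hL w
  simp only [Sym2.mem_iff, huv.symm, huw.symm, hvw, hvw.symm, or_false, or_true, if_true,
    if_false, add_zero] at h₁ h₂
  rw [h₁, ← hlevel]
  rw [← hlevel] at h₂
  rw [← h₂]
  field_simp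
  ring

/-- One vertex `u` outside `B` serves as the common endpoint of the offered pairs, until the
vertices of `S` that are left over have distinct levels. Here `S` is the set of vertices of `B` not
yet used with `u`. -/
theorem winningPosition_of_center {θ D : ℝ} (hθ : 0 < θ) {M : ℕ} (hM : 2 * D + 1 ≤ M)
    {B : Finset V} {u : V} (hu : u ∉ B) (S : Finset V) (hSB : S ⊆ B) (F C : Finset (Sym2 V))
    (hFC : Disjoint F C) (hSF : ∀ v ∈ S, s(u, v) ∈ F)
    (hwin : ∀ F' C' : Finset (Sym2 V), Disjoint F' C' → (∀ e ∈ F, u ∉ e → e ∈ F') →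
      potential θ B F C + (θ - 1) ^ 2 / (2 * θ) *
        (∑ v ∈ S, θ ^ level F C v - ∑ k ∈ Finset.range M, θ ^ k) ≤ potential θ B F' C' →
      WinningPosition 1 (fun C => ∃ v, D ≤ (incidenceCount C v : ℝ)) F' C') :
    WinningPosition 1 (fun C => ∃ v, D ≤ (incidenceCount C v : ℝ)) F C := by
  induction hn : S.card using Nat.strong_induction_on generalizing S F C with
  | _ n ih =>
  subst hn
  by_cases hhigh : ∃ v ∈ S, M ≤ level F C v
  · obtain ⟨v, -, hv⟩ := hhigh
    exact winningPosition_of_le_level hM hFC hv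
  push Not at hhigh
  by_cases hinj : Set.InjOn (level F C) S
  · refine hwin F C hFC (fun e he _ => he) ?_
    have h := sum_pow_le_geom_sum_of_injOn hθ.le hinj hhigh
    have h' : (θ - 1) ^ 2 / (2 * θ) *
        (∑ v ∈ S, θ ^ level F C v - ∑ k ∈ Finset.range M, θ ^ k) ≤ 0 :=
      mul_nonpos_of_nonneg_of_nonpos (by positivity) (by linarith)
    linarith
  · unfold Set.InjOn at hinj
    push Not at hinj
    obtain ⟨v, hv, w, hw, hlevel, hvw⟩ := hinj
    rw [Finset.mem_coe] at hv hw
    have key : ∀ v w : V, v ∈ S → w ∈ S → level F C v = level F C w → v ≠ w →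
        WinningPosition 1 (fun C => ∃ v, D ≤ (incidenceCount C v : ℝ))
          (F \ {s(u, v), s(u, w)}) (insert s(u, v) C) := by
      intro v w hv hw hlevel hvw
      have huS : u ∉ S := fun h => hu (hSB h)
      have huv : u ≠ v := fun h => huS (h ▸ hv)
      have huw : u ≠ w := fun h => huS (h ▸ hw)
      have hef : s(u, v) ≠ s(u, w) := by simp [hvw, huw]
      have hsub : ({v, w} : Finset V) ⊆ S := by
        simp [Finset.insert_subset_iff, hv, hw]
      have hpot := potential_offer_pair hθ hFC hu (hSB hv) (hSB hw) hvw (hSF v hv) (hSF w hw) hlevel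
      have hsum : ∑ z ∈ S \ {v, w}, θ ^ level (F \ {s(u, v), s(u, w)}) (insert s(u, v) C) z =
          ∑ z ∈ S, θ ^ level F C z - (θ ^ level F C v + θ ^ level F C w) := by
        rw [← Finset.sum_sdiff hsub (f := fun z => θ ^ level F C z), Finset.sum_pair hvw,
          add_sub_cancel_right]
        refine Finset.sum_congr rfl fun z hz => ?_
        simp only [Finset.mem_sdiff, Finset.mem_insert, Finset.mem_singleton, not_or] at hz
        have hzu : z ≠ u := fun h => huS (h ▸ hz.1)
        have h := level_offer_pair hFC (hSF v hv) (hSF w hw) hef z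
        simp only [Sym2.mem_iff, hzu, hz.2.1, hz.2.2, or_self, if_false, add_zero] at h
        rw [h]
      refine ih _ ?_ (S \ {v, w}) (Finset.sdiff_subset.trans hSB) _ _
        (disjoint_sdiff_insert hFC (by simp)) ?_ ?_ rfl
      · exact Finset.card_lt_card (Finset.sdiff_ssubset hsub ⟨v, by simp⟩)
      · intro z hz
        simp only [Finset.mem_sdiff, Finset.mem_insert, Finset.mem_singleton, not_or] at hz
        have hzu : z ≠ u := fun h => huS (h ▸ hz.1)
        simp [hSF z hz.1, hz.2.1, hz.2.2, hzu]
      · intro F' C' hFC' hF' hle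
        refine hwin F' C' hFC' (fun e he hue => hF' e ?_ hue) ?_
        · simp only [Finset.mem_sdiff, Finset.mem_insert, Finset.mem_singleton, not_or]
          exact ⟨he, fun h => hue (by simp [h]), fun h => hue (by simp [h])⟩
        · rw [hpot, hsum] at hle
          linarith
    have hne : s(u, v) ≠ s(u, w) := by
      have : u ≠ w := fun h => hu (hSB (h ▸ hw))
      simp [hvw, this]
    refine .offer {s(u, v), s(u, w)} ?_ (Finset.card_pair hne) ?_
    · simp [Finset.insert_subset_iff, hSF v hv, hSF w hw]
    · intro x hx
      rw [Finset.mem_insert, Finset.mem_singleton] at hx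
      obtain rfl | rfl := hx
      · exact key v w hv hw hlevel hvw
      · rw [Finset.pair_comm]
        exact key w v hw hv hlevel.symm hvw.symm

/-- With each further vertex of `A` as center, the excess of the potential over the geometric sum
grows by the factor `1 + (θ - 1) ^ 2 / (2 * θ)`. Once the potential is at least `#B * θ ^ M`, some
vertex of `B` has reached level `M`. -/
theorem winningPosition_of_potential {θ D : ℝ} (hθ : 1 < θ) {M : ℕ} (hM : 2 * D + 1 ≤ M)
    {B : Finset V} (hB : B.Nonempty) (A : Finset V) (hAB : Disjoint A B)
    (F C : Finset (Sym2 V)) (hFC : Disjoint F C) (hF : ∀ u ∈ A, ∀ v ∈ B, s(u, v) ∈ F)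
    (hpot : B.card * θ ^ M ≤ (1 + (θ - 1) ^ 2 / (2 * θ)) ^ A.card *
      (potential θ B F C - ∑ k ∈ Finset.range M, θ ^ k)) :
    WinningPosition 1 (fun C => ∃ v, D ≤ (incidenceCount C v : ℝ)) F C := by
  induction A using Finset.induction_on generalizing F C with
  | empty =>
    have hsum : 0 ≤ ∑ k ∈ Finset.range M, θ ^ k := Finset.sum_nonneg fun _ _ => by positivity
    have h : ∑ _v ∈ B, θ ^ M ≤ ∑ v ∈ B, θ ^ level F C v := by
      rw [Finset.card_empty, pow_zero, one_mul, potential] at hpot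
      rw [Finset.sum_const, nsmul_eq_mul]
      linarith
    obtain ⟨v, -, hv⟩ := Finset.exists_le_of_sum_le hB h
    exact winningPosition_of_le_level hM hFC ((pow_le_pow_iff_right₀ hθ).1 hv)
  | insert u A huA ih =>
    rw [Finset.disjoint_insert_left] at hAB
    have hθ' : 0 < θ := by linarith
    refine winningPosition_of_center hθ' hM hAB.1 B subset_rfl F C hFC
      (hF u (Finset.mem_insert_self u A)) fun F' C' hFC' hF' hle => ?_
    refine ih hAB.2 F' C' hFC' (fun a ha v hv => hF' _ (hF a (Finset.mem_insert_of_mem ha) v hv) ?_)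
      (hpot.trans ?_)
    · rw [Sym2.mem_iff]
      rintro (rfl | rfl)
      · exact huA ha
      · exact hAB.1 hv
    · rw [Finset.card_insert_of_notMem huA, pow_succ, mul_assoc]
      refine mul_le_mul_of_nonneg_left ?_ (by positivity)
      rw [potential] at hle ⊢
      linarith

end EdgeGame

/-! ### The maximum degree game -/

theorem incidenceCount_edgeFinset_top (n : ℕ) (v : Fin n) :
    incidenceCount (⊤ : SimpleGraph (Fin n)).edgeFinset v = n - 1 := by
  have h := SimpleGraph.card_incidenceFinset_eq_degree (⊤ : SimpleGraph (Fin n)) v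
  rw [SimpleGraph.complete_graph_degree, Fintype.card_fin] at h
  rw [← h, SimpleGraph.incidenceFinset_eq_filter, incidenceCount]

theorem clientSet_subset_of_isPlay {α : Type*} [DecidableEq α] {board : Finset α} {q : ℕ}
    {σ : WaiterStrategy α} (hσ : σ.IsLegal board q) {h : History α} (hplay : IsPlay board q σ h) :
    clientSet h ⊆ board := by
  induction hplay with
  | start => simp [clientSet]
  | round h x hplay hfree hx ih =>
    exact Finset.insert_subset (Finset.sdiff_subset ((hσ h hplay hfree).1 hx)) ih

theorem waiterWinsMaxDegree_of_winningPosition {n q : ℕ} {D : ℝ}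
    (h : WinningPosition q (fun C => ∃ v, D ≤ (incidenceCount C v : ℝ))
      (⊤ : SimpleGraph (Fin n)).edgeFinset ∅) : WaiterWinsMaxDegree n q D := by
  obtain ⟨σ, hσ, hwin⟩ := h.hasWinningStrategy
  refine ⟨σ, hσ, fun h hplay hfree => ?_⟩
  obtain ⟨v, hv⟩ := hwin h hplay hfree
  refine ⟨v, ?_⟩
  rwa [degree_fromEdgeSet_eq_incidenceCount]
  intro e he
  have := clientSet_subset_of_isPlay hσ hplay he
  rw [SimpleGraph.mem_edgeFinset] at this
  exact SimpleGraph.not_isDiag_of_mem_edgeSet _ this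

/-- A sufficient condition on the parameters. Here `m` vertices serve as centers, and the vertex
that Waiter aims for has to gain `l` levels. -/
theorem waiterWinsMaxDegree_of_growth {n m l : ℕ} {θ D : ℝ} (hmn : m < n) (hθ : 1 < θ)
    (hD : 2 * D + 2 ≤ n + l)
    (hgeom : θ ^ l / (θ - 1) ≤ ((n : ℝ) - m) / 2)
    (hgrowth : 2 * θ ^ l ≤ (1 + (θ - 1) ^ 2 / (2 * θ)) ^ m) :
    WaiterWinsMaxDegree n 1 D := by
  have hθ' : 0 < θ - 1 := by linarith
  have hmn' : (0 : ℝ) < n - m := sub_pos.2 (Nat.cast_lt.2 hmn)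
  obtain ⟨A, -, hA⟩ := Finset.exists_subset_card_eq (s := (Finset.univ : Finset (Fin n))) (n := m)
    (by simpa using hmn.le)
  have hAc : Aᶜ.card = n - m := by rw [Finset.card_compl, Fintype.card_fin, hA]
  refine waiterWinsMaxDegree_of_winningPosition
    (winningPosition_of_potential hθ (M := n - 1 + l) ?_ (B := Aᶜ) ?_ A disjoint_compl_right _ _
      (Finset.disjoint_empty_right _) ?_ ?_)
  · have : ((n - 1 + l : ℕ) : ℝ) = n - 1 + l := by
      rw [Nat.cast_add, Nat.cast_sub (by omega), Nat.cast_one]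
    linarith
  · rw [← Finset.card_pos]
    omega
  · intro u hu v hv
    rw [SimpleGraph.mem_edgeFinset, SimpleGraph.mem_edgeSet, SimpleGraph.top_adj]
    rintro rfl
    exact Finset.mem_compl.1 hv hu
  · have hpot : potential θ Aᶜ (⊤ : SimpleGraph (Fin n)).edgeFinset ∅ = (n - m) * θ ^ (n - 1) := by
      simp only [potential, level, incidenceCount_edgeFinset_top]
      simp [incidenceCount, hAc, Nat.cast_sub hmn.le]
    have hsum : ∑ k ∈ Finset.range (n - 1 + l), θ ^ k ≤ (n - m) / 2 * θ ^ (n - 1) := by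
      rw [geom_sum_eq hθ.ne', pow_add]
      calc (θ ^ (n - 1) * θ ^ l - 1) / (θ - 1) ≤ (θ ^ (n - 1) * θ ^ l) / (θ - 1) := by
            gcongr; linarith
        _ = θ ^ l / (θ - 1) * θ ^ (n - 1) := by ring
        _ ≤ _ := by gcongr
    rw [hpot, hAc, hA, Nat.cast_sub hmn.le, pow_add]
    calc ((n : ℝ) - m) * (θ ^ (n - 1) * θ ^ l)
          = 2 * θ ^ l * ((n - m) / 2 * θ ^ (n - 1)) := by ring
      _ ≤ (1 + (θ - 1) ^ 2 / (2 * θ)) ^ m * ((n - m) / 2 * θ ^ (n - 1)) := by gcongr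
      _ ≤ _ := by
        gcongr
        linarith

/-- The center count `n / 2` and the base `θ = 1 + √(n log n) / n` satisfy the growth conditions for
a gain of about `√(n log n) / 250` levels: then `θ ^ l` is at most `n ^ (1 / 200)`, while the
potential grows by a factor of at least `n ^ (1 / 24)`. -/
theorem waiterWinsMaxDegree_of_large {n : ℕ} (hn : 9000000 ≤ n) (hlog : 48 ≤ Real.log n) :
    WaiterWinsMaxDegree n 1 ((n : ℝ) / 2 + Real.sqrt ((n : ℝ) * Real.log (n : ℝ)) / 500) := by
  have hn' : (9000000 : ℝ) ≤ n := by exact_mod_cast hn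
  have hn0 : (0 : ℝ) < n := by linarith
  have hexp : Real.exp (Real.log n) = n := Real.exp_log hn0
  have hlogn : Real.log n ≤ n := (Real.log_le_sub_one_of_pos hn0).trans (by linarith)
  set L := Real.log (n : ℝ) with hL
  set s := Real.sqrt ((n : ℝ) * L) with hs
  have hss : s ^ 2 = n * L := Real.sq_sqrt (by positivity)
  have hs3000 : 3000 ≤ s := Real.le_sqrt_of_sq_le (by nlinarith)
  have hsn : s ≤ n := Real.sqrt_le_iff.2 ⟨hn0.le, by nlinarith⟩
  set ε := s / n with hε
  have hε0 : 0 < ε := by positivity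
  have hε1 : ε ≤ 1 := (div_le_one hn0).2 hsn
  have hεs : ε * s = L := by
    rw [hε, div_mul_eq_mul_div, ← sq, hss, mul_div_cancel_left₀ _ hn0.ne']
  have hεn : ε ^ 2 * n = L := by
    rw [← hεs, hε]
    field_simp
  have hm₁ : (n : ℝ) / 3 ≤ ((n / 2 : ℕ) : ℝ) := by
    have h : n ≤ 3 * (n / 2) := by omega
    have h' : (n : ℝ) ≤ 3 * ((n / 2 : ℕ) : ℝ) := by exact_mod_cast h
    linarith
  have hm₂ : ((n / 2 : ℕ) : ℝ) ≤ n / 2 := Nat.cast_div_le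
  have hl : ((⌈s / 250⌉₊ + 2 : ℕ) : ℝ) ≤ s / 200 := by
    have := Nat.ceil_lt_add_one (show 0 ≤ s / 250 by positivity)
    push_cast
    linarith
  have hpow : (1 + ε) ^ (⌈s / 250⌉₊ + 2) ≤ Real.exp (L / 200) := by
    calc (1 + ε) ^ (⌈s / 250⌉₊ + 2) ≤ Real.exp ε ^ (⌈s / 250⌉₊ + 2) := by
          gcongr
          linarith [Real.add_one_le_exp ε]
      _ = Real.exp (((⌈s / 250⌉₊ + 2 : ℕ) : ℝ) * ε) := (Real.exp_nat_mul _ _).symm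
      _ ≤ Real.exp (L / 200) := by
          refine Real.exp_le_exp.2 ((mul_le_mul_of_nonneg_right hl hε0.le).trans_eq ?_)
          rw [← hεs]
          ring
  refine waiterWinsMaxDegree_of_growth (m := n / 2) (l := ⌈s / 250⌉₊ + 2) (θ := 1 + ε) (by omega)
    (by linarith) ?_ ?_ ?_
  · have := Nat.le_ceil (s / 250)
    push_cast
    linarith
  · have h4 : 4 * Real.exp (L / 200) ≤ s := by
      refine Real.le_sqrt_of_sq_le ?_
      calc (4 * Real.exp (L / 200)) ^ 2 = Real.exp (L / 100) * 16 := by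
            rw [mul_pow, ← Real.exp_nat_mul]
            ring_nf
        _ ≤ Real.exp L * L := by
            gcongr <;> linarith
        _ = n * L := by rw [hexp]
    rw [add_sub_cancel_left, div_le_iff₀ hε0]
    calc (1 + ε) ^ (⌈s / 250⌉₊ + 2) ≤ s / 4 := by linarith
      _ = n / 4 * ε := by
          rw [hε]
          field_simp
      _ ≤ (n - ((n / 2 : ℕ) : ℝ)) / 2 * ε :=
          mul_le_mul_of_nonneg_right (by linarith) hε0.le
  · rw [add_sub_cancel_left]
    have hδ : ε ^ 2 / 4 ≤ ε ^ 2 / (2 * (1 + ε)) := by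
      gcongr
      linarith
    have hε2 : ε ^ 2 ≤ 1 := pow_le_one₀ hε0.le hε1
    have hbase : Real.exp (ε ^ 2 / 8) ≤ 1 + ε ^ 2 / (2 * (1 + ε)) := by
      refine (Real.exp_bound_div_one_sub_of_interval (by positivity) (by linarith)).trans
        (le_trans ?_ (add_le_add_right hδ 1))
      rw [div_le_iff₀ (by linarith)]
      nlinarith [sq_nonneg ε]
    calc 2 * (1 + ε) ^ (⌈s / 250⌉₊ + 2) ≤ Real.exp 1 * Real.exp (L / 200) := by
          gcongr
          linarith [Real.add_one_le_exp 1]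
      _ ≤ Real.exp (((n / 2 : ℕ) : ℝ) * (ε ^ 2 / 8)) := by
          rw [← Real.exp_add, Real.exp_le_exp]
          have : n / 3 * (ε ^ 2 / 8) ≤ ((n / 2 : ℕ) : ℝ) * (ε ^ 2 / 8) := by gcongr
          linarith
      _ = Real.exp (ε ^ 2 / 8) ^ (n / 2) := Real.exp_nat_mul _ _
      _ ≤ _ := by gcongr

end WaiterClient

theorem theorem2 :
    ∀ᶠ n : ℕ in Filter.atTop,
      WaiterClient.WaiterWinsMaxDegree n 1
        ((n : ℝ) / 2 + Real.sqrt ((n : ℝ) * Real.log (n : ℝ)) / 500) := by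
  filter_upwards [Filter.eventually_ge_atTop 9000000,
    (Real.tendsto_log_atTop.comp tendsto_natCast_atTop_atTop).eventually_ge_atTop 48] with n hn hlog
  exact WaiterClient.waiterWinsMaxDegree_of_large hn hlog
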